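/- For a partition $\lambda_1\ge\lambda_2\ge\cdots$ (with $\lambda_j=0$ beyond the last part) and an integer $m\ge 2$, the alternating sum type of $\lambda$ modulo $m$ is $(\Sigma_1,\dots,\Sigma_{m-1})$, where $\Sigma_c=\sum_{b\ge 0}(\lambda_{bm+c}-\lambda_{bm+c+1})$. The conjecture for the modulus $m$ states that, for all integers $n\ge 0$ and $s_1,\dots,s_{m-1}\ge 0$, the number of partitions of $n$ in which every part is repeated at most $m-1$ times and whose alternating sum type modulo $m$ is $(s_1,\dots,s_{m-1})$ equals the number of partitions of $n$ with no part divisible by $m$ and with exactly $s_c$ parts congruent to $c$ modulo $m$ for every $1\le c\le m-1$. **Theorem 5.3.** Let $d\ge 1$ and $1\le i\le d+1$, and suppose that the conjecture is true for the modulus $m=2d+1$. Then for every $n\ge 1$, the number of partitions of $n$ such that at most $i-1$ of the parts are equal to $1$ and, for every $j\ge 1$, at most $d-1$ of the parts (counted with multiplicity) are equal to $j$ or $j+1$, equals the number of partitions of $n$ with every part repeated at most $2d$ times and with alternating sum type $(\Sigma_1,\dots,\Sigma_{2d})\ne(0,\dots,0)$ modulo $2d+1$ satisfying $\Sigma_i=\Sigma_{2d+1-i}=0$.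 -/

import Mathlib

/-- The `j`-th largest part `λ_j` (`j ≥ 1`) of a partition, with `λ_j = 0` beyond the last part. -/
def Nat.Partition.nthPart {n : ℕ} (p : n.Partition) (j : ℕ) : ℕ :=
  (p.parts.sort (· ≥ ·)).getD (j - 1) 0

/-- The `c`-th entry `Σ_c` (`1 ≤ c ≤ m - 1`) of the alternating sum type of a partition modulo `m`,
`Σ_c = ∑_{b ≥ 0} (λ_{bm+c} - λ_{bm+c+1})`. The differences are nonnegative because the `λ_j`
decrease, and for `m ≥ 1` all terms in which `b` is at least the number of parts vanish. -/
def Nat.Partition.altSum {n : ℕ} (m : ℕ) (p : n.Partition) (c : ℕ) : ℕ :=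
  ∑ b ∈ Finset.range p.parts.card, (p.nthPart (b * m + c) - p.nthPart (b * m + c + 1))

/-- The `c`-th entry `l_c` (`1 ≤ c ≤ m - 1`) of the length type of a partition modulo `m`: the
number of parts congruent to `c` modulo `m`. -/
def Nat.Partition.lengthType {n : ℕ} (m : ℕ) (p : n.Partition) (c : ℕ) : ℕ :=
  (p.parts.filter (fun x => x ≡ c [MOD m])).card

/-- No part is repeated more than `r` times. -/
def Nat.Partition.RepeatedAtMost {n : ℕ} (r : ℕ) (p : n.Partition) : Prop :=
  ∀ x : ℕ, p.parts.count x ≤ r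

/-- The conjecture for the modulus `m ≥ 2`: for all `n` and all `(s 1, …, s (m - 1))`, the number of
partitions of `n` with parts repeated at most `m - 1` times and alternating sum type
`(s 1, …, s (m - 1))` equals the number of partitions of `n` with no part divisible by `m` and
length type `(s 1, …, s (m - 1))`. -/
def EulerConjecture (m : ℕ) : Prop :=
  ∀ (n : ℕ) (s : ℕ → ℕ),
    {p : n.Partition | p.RepeatedAtMost (m - 1) ∧
      ∀ c ∈ Finset.Icc 1 (m - 1), p.altSum m c = s c}.ncard =
    {p : n.Partition | (∀ x ∈ p.parts, ¬ m ∣ x) ∧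
      ∀ c ∈ Finset.Icc 1 (m - 1), p.lengthType m c = s c}.ncard

/-- Gordon's condition: at most `i - 1` parts equal `1`, and for every pair of consecutive positive
integers `j`, `j + 1` at most `d - 1` parts lie in `{j, j + 1}` (used for `d, i ≥ 1`). -/
def Nat.Partition.GordonCondition {n : ℕ} (d i : ℕ) (p : n.Partition) : Prop :=
  p.parts.count 1 ≤ i - 1 ∧
    ∀ j : ℕ, 1 ≤ j → p.parts.count j + p.parts.count (j + 1) ≤ d - 1

/-! The conjecture turns alternating sums into residues: the right-hand side becomes the number of
partitions of `n` with no part congruent to `0`, `i` or `-i` modulo `2d+1`. The type is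
automatically nonzero because `n ≥ 1` forces a part. What remains is Gordon's partition theorem; `i
= d+1` reduces to `i = d`.

Gordon's theorem (`ncard_gordonCondition`) is proved by generating functions. Splitting on the
multiplicity of the smallest allowed part gives a recurrence (`gordonSet_succ`). Andrews' series
satisfies the same recurrence up to a telescoping term (`andrewsTerm_recurrence`), hence represents
the generating function times a `q`-factorial. At `m = 0` that series is the theta series of the
Jacobi triple product, which sums to a product over three residue classes; cancelling these factors
leaves the allowed residues.

There are no infinite sums or products: each identity is finite, or a congruence modulo `X ^ L` for
arbitrary `L`. -/

/-! ### Gaussian binomials and the `q`-binomial theorem -/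

/-- The `q`-factorial product `∏_{j=1}^{n} (1 - q^j)`. -/
def qFactorial {R : Type*} [CommRing R] (q : R) (n : ℕ) : R :=
  ∏ j ∈ Finset.range n, (1 - q ^ (j + 1))

theorem qFactorial_succ {R : Type*} [CommRing R] (q : R) (n : ℕ) :
    qFactorial q (n + 1) = qFactorial q n * (1 - q ^ (n + 1)) :=
  Finset.prod_range_succ _ _

theorem qFactorial_add {R : Type*} [CommRing R] (q : R) (a b : ℕ) :
    qFactorial q (a + b) = qFactorial q a * ∏ j ∈ Finset.range b, (1 - q ^ (a + j + 1)) :=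
  Finset.prod_range_add _ _ _

/-- The Gaussian binomial coefficient, by its Pascal recursion. -/
def gaussBinom {R : Type*} [CommRing R] (q : R) : ℕ → ℕ → R
  | _, 0 => 1
  | 0, _ + 1 => 0
  | n + 1, k + 1 => gaussBinom q n k + q ^ (k + 1) * gaussBinom q n (k + 1)

theorem gaussBinom_zero_right {R : Type*} [CommRing R] (q : R) (n : ℕ) :
    gaussBinom q n 0 = 1 := by
  cases n <;> rfl

theorem gaussBinom_eq_zero_of_lt {R : Type*} [CommRing R] (q : R) {n k : ℕ} (h : n < k) :
    gaussBinom q n k = 0 := by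
  induction n generalizing k with
  | zero => obtain ⟨k, rfl⟩ := Nat.exists_eq_succ_of_ne_zero h.ne'; rfl
  | succ n ih =>
    obtain ⟨k, rfl⟩ := Nat.exists_eq_succ_of_ne_zero (Nat.ne_zero_of_lt h)
    simp only [gaussBinom]
    rw [ih (by omega), ih (by omega)]
    ring

theorem gaussBinom_self {R : Type*} [CommRing R] (q : R) (n : ℕ) : gaussBinom q n n = 1 := by
  induction n with
  | zero => rfl
  | succ n ih => simp [gaussBinom, ih, gaussBinom_eq_zero_of_lt q (Nat.lt_succ_self n)]

theorem gaussBinom_mul_qFactorial {R : Type*} [CommRing R] (q : R) (n k : ℕ) :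
    gaussBinom q (n + k) k * qFactorial q k * qFactorial q n = qFactorial q (n + k) := by
  induction n generalizing k with
  | zero => simp [gaussBinom_self, qFactorial]
  | succ n ihn =>
    induction k with
    | zero => simp [gaussBinom_zero_right, qFactorial]
    | succ k ihk =>
      have h1 := ihn (k + 1)
      have e1 : n + 1 + (k + 1) = (n + k + 1) + 1 := by ring
      have e2 : n + (k + 1) = n + k + 1 := by ring
      have e3 : n + 1 + k = n + k + 1 := by ring
      rw [e2] at h1
      rw [e3] at ihk
      rw [e1, gaussBinom, qFactorial_succ q (n + k + 1), qFactorial_succ q n]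
      rw [qFactorial_succ q n] at ihk
      rw [qFactorial_succ q k] at h1 ⊢
      -- The two weights sum to `1 - q ^ (n + k + 2)`, the new factor of the larger factorial.
      linear_combination (1 - q ^ (k + 1)) * ihk + q ^ (k + 1) * (1 - q ^ (n + 1)) * h1

/-- The homogeneous form in `a` and `b` lets the triple product be derived without negative powers.
Removing the factor `j = 0` replaces `b` by `b * q`, so the induction generalizes `b`. -/
theorem prod_add_mul_pow_eq_sum_gaussBinom {R : Type*} [CommRing R] (q a b : R) (n : ℕ) :
    ∏ j ∈ Finset.range n, (a + b * q ^ j) =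
      ∑ r ∈ Finset.range (n + 1), gaussBinom q n r * q ^ r.choose 2 * b ^ r * a ^ (n - r) := by
  induction n generalizing b with
  | zero => simp [gaussBinom]
  | succ n ih =>
    rw [Finset.prod_range_succ']
    have h : ∀ j, a + b * q ^ (j + 1) = a + b * q * q ^ j := fun j => by ring
    simp only [h, ih (b * q), pow_zero, mul_one]
    rw [Finset.sum_range_succ' _ (n + 1), mul_add]
    have hA : (∑ r ∈ Finset.range (n + 1),
        gaussBinom q n r * q ^ r.choose 2 * (b * q) ^ r * a ^ (n - r)) * a =
        (∑ r ∈ Finset.range (n + 1), q ^ (r + 1) * gaussBinom q n (r + 1) *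
          q ^ (r + 1).choose 2 * b ^ (r + 1) * a ^ (n - r)) + a ^ (n + 1) := by
      rw [Finset.sum_range_succ', Finset.sum_range_succ _ n,
        gaussBinom_eq_zero_of_lt q (Nat.lt_succ_self n), add_mul, Finset.sum_mul]
      simp only [gaussBinom_zero_right]
      congr 1
      · simp only [mul_zero, zero_mul, add_zero]
        refine Finset.sum_congr rfl fun r hr => ?_
        have : n - r = n - (r + 1) + 1 := by have := Finset.mem_range.1 hr; omega
        rw [this]
        ring
      · simp [pow_succ]
    rw [hA, Finset.sum_mul]
    simp only [gaussBinom, Nat.succ_sub_succ]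
    rw [add_right_comm, ← Finset.sum_add_distrib]
    congr 1
    · refine Finset.sum_congr rfl fun r _ => ?_
      have : (r + 1).choose 2 = r + r.choose 2 := by simp [Nat.choose_succ_succ']
      rw [this]
      ring
    · simp

/-! ### Andrews' series and its recurrence -/

/-- The summand of Andrews' series `∑ (-1)^n x^{kmn + (2k+1)n(n+1)/2 - in} (1 - x^{i(m+2n+1)})
(x^{n+1}; x)_m` with `k = i + l`. -/
def andrewsTerm {R : Type*} [CommRing R] (x : R) (i l m n : ℕ) : R :=
  (-1) ^ n * x ^ ((i + l) * m * n + (2 * (i + l) + 1) * n.choose 2 + (i + 2 * l + 1) * n) *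
    (1 - x ^ (i * (m + 2 * n + 1))) * ∏ j ∈ Finset.range m, (1 - x ^ (n + 1 + j))

/-- The telescoping term in the recurrence for partial sums of Andrews' series. -/
def andrewsBoundary {R : Type*} [CommRing R] (x : R) (i l m n : ℕ) : R :=
  (-1) ^ n * x ^ ((i + 1 + l) * m * n + (2 * (i + 1 + l) + 1) * n.choose 2 + (i + 2 * l + 2) * n) *
    ∏ j ∈ Finset.range (m + 1), (1 - x ^ (n + j))

theorem andrewsTerm_recurrence {R : Type*} [CommRing R] (x : R) (i l m n : ℕ) :
    andrewsTerm x (i + 1) l m n = andrewsTerm x i (l + 1) m n +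
      x ^ ((m + 1) * i) * andrewsTerm x (l + 1) i (m + 1) n +
        (andrewsBoundary x i l m n - andrewsBoundary x i l m (n + 1)) := by
  simp only [andrewsTerm, andrewsBoundary]
  have h : (n + 1).choose 2 = n + n.choose 2 := by simp [Nat.choose_succ_succ']
  have h2 : ∏ j ∈ Finset.range (m + 1), (1 - x ^ (n + j)) =
      (∏ j ∈ Finset.range m, (1 - x ^ (n + 1 + j))) * (1 - x ^ n) := by
    rw [Finset.prod_range_succ']
    congr 1
    exact Finset.prod_congr rfl fun j _ => by ring
  rw [h, h2, Finset.prod_range_succ _ m]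
  -- All the products share this factor; the rest is a polynomial identity in powers of `x`.
  generalize ∏ j ∈ Finset.range m, (1 - x ^ (n + 1 + j)) = P
  ring

theorem sum_andrewsTerm_recurrence {R : Type*} [CommRing R] (x : R) (i l m N : ℕ) :
    ∑ n ∈ Finset.range N, andrewsTerm x (i + 1) l m n =
      ∑ n ∈ Finset.range N, andrewsTerm x i (l + 1) m n +
      x ^ ((m + 1) * i) * ∑ n ∈ Finset.range N, andrewsTerm x (l + 1) i (m + 1) n -
        andrewsBoundary x i l m N := by
  simp only [andrewsTerm_recurrence x i l m, Finset.sum_add_distrib, Finset.mul_sum,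
    Finset.sum_range_sub']
  -- The factor `j = 0` of the product is `1 - x ^ 0`.
  have : andrewsBoundary x i l m 0 = 0 := by
    simp [andrewsBoundary, Finset.prod_range_succ']
  rw [this]
  ring

theorem pow_eq_zero_of_exponent_le {R : Type*} [CommRing R] {x : R} {L n : ℕ} (hx : x ^ L = 0)
    (h : L ≤ n) : x ^ n = 0 := by
  rw [← Nat.sub_add_cancel h, pow_add, hx, mul_zero]

theorem qFactorial_eq_of_le {R : Type*} [CommRing R] {x : R} {L n : ℕ} (hx : x ^ L = 0)
    (h : L ≤ n) : qFactorial x n = qFactorial x L := by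
  obtain ⟨b, rfl⟩ := Nat.exists_eq_add_of_le h
  rw [qFactorial_add, Finset.prod_eq_one, mul_one]
  intro j _
  rw [pow_eq_zero_of_exponent_le hx (by omega), sub_zero]

/-- For `m ≥ L` the exponent of every term with `n > 0` is at least `L`, so only `n = 0` survives.
This is the base of the induction on the recurrence. -/
theorem sum_andrewsTerm_of_le {R : Type*} [CommRing R] {x : R} {L m : ℕ} (hx : x ^ L = 0)
    (hL : 0 < L) (h : L ≤ m) (i l : ℕ) :
    ∑ n ∈ Finset.range L, andrewsTerm x (i + 1) l m n = qFactorial x L := by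
  rw [Finset.sum_eq_single_of_mem 0 (Finset.mem_range.2 hL)]
  · have h1 : x ^ ((i + 1) * (m + 2 * 0 + 1)) = 0 :=
      pow_eq_zero_of_exponent_le hx (by nlinarith)
    rw [← qFactorial_eq_of_le hx h]
    simp only [andrewsTerm, h1, qFactorial]
    simp [add_comm]
  · intro n _ hn
    have h1 : x ^ ((i + 1 + l) * m * n + (2 * (i + 1 + l) + 1) * n.choose 2 +
        (i + 1 + 2 * l + 1) * n) = 0 := by
      refine pow_eq_zero_of_exponent_le hx ?_
      have : m ≤ (i + 1 + l) * m * n := by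
        have h3 : 1 ≤ (i + 1 + l) * n := Nat.mul_pos (by omega) (by omega)
        nlinarith
      omega
    simp only [andrewsTerm, h1]
    simp

/-- A family satisfying Gordon's recurrence is given by Andrews' series. -/
theorem sum_andrewsTerm_eq_qFactorial_mul {R : Type*} [CommRing R] {x : R} {L : ℕ} (hL : 0 < L)
    (hx : x ^ L = 0) (G : ℕ → ℕ → ℕ → R) (h0 : ∀ l m, G 0 l m = 0)
    (hrec : ∀ i l m, G (i + 1) l m = G i (l + 1) m + x ^ ((m + 1) * i) * G (l + 1) i (m + 1))
    (h1 : ∀ i l m, L ≤ m → G (i + 1) l m = 1) (i l m : ℕ) :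
    ∑ n ∈ Finset.range L, andrewsTerm x i l m n = qFactorial x L * G i l m := by
  have hz : ∀ l m, ∑ n ∈ Finset.range L, andrewsTerm x 0 l m n = qFactorial x L * G 0 l m := by
    intro l m
    rw [h0, mul_zero]
    exact Finset.sum_eq_zero fun n _ => by simp [andrewsTerm]
  -- The recurrence lowers `i` or raises `m`, so the outer induction is on the distance `d` from `m`
  -- to `L` and the inner one on `i`.
  have key : ∀ d i l m, L ≤ m + d →
      ∑ n ∈ Finset.range L, andrewsTerm x i l m n = qFactorial x L * G i l m := by
    intro d
    induction d with
    | zero =>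
      intro i l m h
      cases i with
      | zero => exact hz l m
      | succ i => rw [sum_andrewsTerm_of_le (m := m) hx hL h, h1 i l m h, mul_one]
    | succ d ihd =>
      intro i
      induction i with
      | zero => exact fun l m _ => hz l m
      | succ i ihi =>
        intro l m h
        have hb : andrewsBoundary x i l m L = 0 := by
          have : x ^ ((i + 1 + l) * m * L + (2 * (i + 1 + l) + 1) * L.choose 2 +
              (i + 2 * l + 2) * L) = 0 :=
            pow_eq_zero_of_exponent_le hx
              ((Nat.le_mul_of_pos_left L (Nat.succ_pos _)).trans (Nat.le_add_left _ _))
          simp [andrewsBoundary, this]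
        rw [sum_andrewsTerm_recurrence, ihi _ _ h, ihd _ _ (m + 1) (by omega), hb, hrec i l m]
        ring
  exact key L i l m (Nat.le_add_left _ _)

/-! ### Generating functions of sets of multisets -/

/-- The generating function, by sum, of a set of multisets of natural numbers. -/
noncomputable def multisetGenFun (C : Set (Multiset ℕ)) : PowerSeries ℤ :=
  PowerSeries.mk fun n => ({s | s ∈ C ∧ s.sum = n}.ncard : ℤ)

theorem finite_multiset_sum_eq {C : Set (Multiset ℕ)} (hC : ∀ s ∈ C, 0 ∉ s) (n : ℕ) :
    {s | s ∈ C ∧ s.sum = n}.Finite := by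
  refine (Set.finite_range fun p : n.Partition => p.parts).subset ?_
  rintro s ⟨hs, hn⟩
  exact ⟨⟨s, fun {a} ha => Nat.pos_of_ne_zero fun h => hC s hs (h ▸ ha), hn⟩, rfl⟩

theorem multisetGenFun_union {C D : Set (Multiset ℕ)} (hC : ∀ s ∈ C, 0 ∉ s)
    (hD : ∀ s ∈ D, 0 ∉ s) (h : Disjoint C D) :
    multisetGenFun (C ∪ D) = multisetGenFun C + multisetGenFun D := by
  ext n
  simp only [multisetGenFun, map_add, PowerSeries.coeff_mk]
  have : {s | s ∈ C ∪ D ∧ s.sum = n} = {s | s ∈ C ∧ s.sum = n} ∪ {s | s ∈ D ∧ s.sum = n} := by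
    ext s
    simp only [Set.mem_union, Set.mem_ofPred_eq]
    tauto
  rw [this, Set.ncard_union_eq _ (finite_multiset_sum_eq hC n) (finite_multiset_sum_eq hD n)]
  · push_cast; rfl
  · exact h.mono (fun s hs => hs.1) fun s hs => hs.1

theorem multisetGenFun_image_add (C : Set (Multiset ℕ)) (t : Multiset ℕ) :
    multisetGenFun ((· + t) '' C) = PowerSeries.X ^ t.sum * multisetGenFun C := by
  ext n
  rw [PowerSeries.coeff_X_pow_mul']
  simp only [multisetGenFun, PowerSeries.coeff_mk]
  split_ifs with h
  · have : {s | s ∈ (· + t) '' C ∧ s.sum = n} = (· + t) '' {s | s ∈ C ∧ s.sum = n - t.sum} := by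
      ext s
      constructor
      · rintro ⟨⟨u, hu, rfl⟩, hs⟩
        refine ⟨u, ⟨hu, ?_⟩, rfl⟩
        simp only [Multiset.sum_add] at hs
        omega
      · rintro ⟨u, ⟨hu, hs⟩, rfl⟩
        refine ⟨⟨u, hu, rfl⟩, ?_⟩
        simp only [Multiset.sum_add, hs]
        omega
    rw [this, Set.ncard_image_of_injective _ (add_left_injective t)]
  · have : {s | s ∈ (· + t) '' C ∧ s.sum = n} = ∅ := by
      refine Set.eq_empty_of_forall_notMem ?_
      rintro s ⟨⟨u, hu, rfl⟩, hs⟩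
      simp only [Multiset.sum_add] at hs
      omega
    rw [this, Set.ncard_empty, Nat.cast_zero]

theorem X_pow_dvd_multisetGenFun_sub_one {C : Set (Multiset ℕ)} {m : ℕ} (h0 : 0 ∈ C)
    (h : ∀ s ∈ C, ∀ y ∈ s, m ≤ y) :
    PowerSeries.X ^ m ∣ multisetGenFun C - 1 := by
  rw [PowerSeries.X_pow_dvd_iff]
  intro n hn
  have hs : ∀ s ∈ C, s.sum = n → s = 0 := by
    intro s hs hsn
    refine Multiset.eq_zero_of_forall_notMem fun y hy => ?_
    have h1 := h s hs y hy
    have h2 := Multiset.single_le_sum (fun _ _ => Nat.zero_le _) y hy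
    omega
  simp only [multisetGenFun, map_sub, PowerSeries.coeff_mk, PowerSeries.coeff_one]
  split_ifs with h2
  · have : {s | s ∈ C ∧ s.sum = n} = {0} := by
      ext s
      constructor
      · exact fun h3 => hs s h3.1 h3.2
      · rintro rfl
        exact ⟨h0, by simp [h2]⟩
    simp [this]
  · have : {s | s ∈ C ∧ s.sum = n} = ∅ := by
      refine Set.eq_empty_of_forall_notMem ?_
      rintro s ⟨h3, h4⟩
      rw [hs s h3 h4] at h4
      exact h2 (by simpa using h4.symm)
    simp [this]

/-! ### The recurrence for Gordon's multisets -/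

/-- Multisets of integers greater than `m` satisfying Gordon's condition, with fewer than `i`
copies of `m + 1`, where `k = i + l`. -/
def gordonSet (i l m : ℕ) : Set (Multiset ℕ) :=
  {s | (∀ y ∈ s, m < y) ∧ s.count (m + 1) < i ∧
    ∀ j, m < j → s.count j + s.count (j + 1) < i + l}

theorem gordonSet_zero_notMem {i l m : ℕ} (s) (hs : s ∈ gordonSet i l m) : 0 ∉ s :=
  fun h => absurd (hs.1 0 h) (Nat.not_lt_zero _)

/-- Either `m + 1` occurs fewer than `i` times, or exactly `i` times. In the second case delete
these copies: the bound on the pair `m + 1`, `m + 2` leaves room for fewer than `l + 1` copies of `m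
+ 2`. -/
theorem gordonSet_succ (i l m : ℕ) :
    gordonSet (i + 1) l m = gordonSet i (l + 1) m ∪
      (· + Multiset.replicate i (m + 1)) '' gordonSet (l + 1) i (m + 1) := by
  ext s
  simp only [gordonSet, Set.mem_union, Set.mem_ofPred_eq, Set.mem_image]
  constructor
  · rintro ⟨h1, h2, h3⟩
    rcases Nat.lt_succ_iff_lt_or_eq.1 h2 with h | h
    · exact Or.inl ⟨h1, h, fun j hj => by have := h3 j hj; omega⟩
    · right
      have hle : Multiset.replicate i (m + 1) ≤ s := by
        rw [← h]; exact Multiset.le_count_iff_replicate_le.1 le_rfl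
      have hc : ∀ j, j ≠ m + 1 → (s - Multiset.replicate i (m + 1)).count j = s.count j := by
        intro j hj
        rw [Multiset.count_sub, Multiset.count_replicate, if_neg (Ne.symm hj), Nat.sub_zero]
      have hc1 : (s - Multiset.replicate i (m + 1)).count (m + 1) = 0 := by
        rw [Multiset.count_sub, Multiset.count_replicate_self, h, Nat.sub_self]
      refine ⟨s - Multiset.replicate i (m + 1), ⟨?_, ?_, ?_⟩, Multiset.sub_add_cancel hle⟩
      · intro y hy
        have hy1 := h1 y (Multiset.mem_of_le (Multiset.sub_le_self _ _) hy)
        rcases Nat.lt_or_ge (m + 1) y with h4 | h4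
        · exact h4
        · obtain rfl : y = m + 1 := by omega
          exact absurd (Multiset.count_pos.2 hy) (by omega)
      · rw [hc _ (by omega)]
        have := h3 (m + 1) (by omega)
        omega
      · intro j hj
        rw [hc _ (by omega), hc _ (by omega)]
        have := h3 j (by omega)
        omega
  · rintro (⟨h1, h2, h3⟩ | ⟨t, ⟨h1, h2, h3⟩, rfl⟩)
    · exact ⟨h1, by omega, fun j hj => by have := h3 j hj; omega⟩
    · have hc : ∀ j, j ≠ m + 1 → (t + Multiset.replicate i (m + 1)).count j = t.count j := by
        intro j hj
        rw [Multiset.count_add, Multiset.count_replicate, if_neg (Ne.symm hj), Nat.add_zero]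
      have hc1 : (t + Multiset.replicate i (m + 1)).count (m + 1) = i := by
        rw [Multiset.count_add, Multiset.count_replicate_self,
          Multiset.count_eq_zero.2 fun h => lt_irrefl _ (h1 _ h), Nat.zero_add]
      refine ⟨?_, by omega, ?_⟩
      · intro y hy
        rcases Multiset.mem_add.1 hy with h | h
        · have := h1 y h; omega
        · rw [Multiset.eq_of_mem_replicate h]; omega
      · intro j hj
        rw [hc (j + 1) (by omega)]
        by_cases hj1 : j = m + 1
        · subst hj1
          rw [hc1]; omega
        · rw [hc j hj1]
          have := h3 j (by omega)
          omega

theorem multisetGenFun_gordonSet_succ (i l m : ℕ) :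
    multisetGenFun (gordonSet (i + 1) l m) = multisetGenFun (gordonSet i (l + 1) m) +
      PowerSeries.X ^ ((m + 1) * i) * multisetGenFun (gordonSet (l + 1) i (m + 1)) := by
  have himg : ∀ s ∈ (· + Multiset.replicate i (m + 1)) '' gordonSet (l + 1) i (m + 1),
      s ∈ gordonSet (i + 1) l m := fun s hs => gordonSet_succ i l m ▸ Or.inr hs
  rw [gordonSet_succ, multisetGenFun_union gordonSet_zero_notMem
    fun s hs => gordonSet_zero_notMem s (himg s hs)]
  · rw [multisetGenFun_image_add, Multiset.sum_replicate, smul_eq_mul, mul_comm i]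
  · rw [Set.disjoint_left]
    rintro _ h1 ⟨t, -, rfl⟩
    have := h1.2.1
    rw [Multiset.count_add, Multiset.count_replicate_self] at this
    omega

theorem multisetGenFun_gordonSet_zero (l m : ℕ) : multisetGenFun (gordonSet 0 l m) = 0 := by
  have : gordonSet 0 l m = ∅ := Set.eq_empty_of_forall_notMem fun s hs => Nat.not_lt_zero _ hs.2.1
  ext n
  simp [multisetGenFun, this]

theorem X_pow_dvd_multisetGenFun_gordonSet_sub_one (i l m : ℕ) :
    PowerSeries.X ^ m ∣ multisetGenFun (gordonSet (i + 1) l m) - 1 :=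
  X_pow_dvd_multisetGenFun_sub_one ⟨by simp, by simp, fun j _ => by simp⟩
    (fun s hs y hy => (hs.1 y hy).le)

/-! ### Multisets with parts in a prescribed set -/

/-- Multisets of elements of `S`. -/
def multisetsIn (S : Set ℕ) : Set (Multiset ℕ) := {s | ∀ y ∈ s, y ∈ S}

/-- A multiset either avoids `a` or arises uniquely by adding one `a`. Iterating over a finite set
replaces Euler's infinite product. -/
theorem one_sub_X_pow_mul_multisetGenFun {S : Set ℕ} {a : ℕ} (ha : a ∈ S) (hS : 0 ∉ S) :
    (1 - PowerSeries.X ^ a) * multisetGenFun (multisetsIn S) =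
      multisetGenFun (multisetsIn (S \ {a})) := by
  have hz : ∀ s ∈ multisetsIn S, 0 ∉ s := fun s hs h => hS (hs 0 h)
  have hU : multisetsIn S = multisetsIn (S \ {a}) ∪ (· + {a}) '' multisetsIn S := by
    ext s
    constructor
    · intro hs
      by_cases h : a ∈ s
      · refine Or.inr ⟨s.erase a, fun y hy => hs y (Multiset.mem_of_mem_erase hy), ?_⟩
        exact (add_comm _ _).trans (Multiset.cons_erase h)
      · exact Or.inl fun y hy => ⟨hs y hy, fun e => h (Set.mem_singleton_iff.1 e ▸ hy)⟩
    · rintro (h | ⟨t, ht, rfl⟩)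
      · exact fun y hy => (h y hy).1
      · intro y hy
        rcases Multiset.mem_add.1 hy with h | h
        · exact ht y h
        · exact Multiset.mem_singleton.1 h ▸ ha
  have hd : Disjoint (multisetsIn (S \ {a})) ((· + {a}) '' multisetsIn S) := by
    rw [Set.disjoint_left]
    rintro _ h1 ⟨t, -, rfl⟩
    exact (h1 a (by simp)).2 rfl
  have h1 := multisetGenFun_union (fun s hs h => hS (hs 0 h).1)
    (fun s hs => hz s (hU ▸ Or.inr hs)) hd
  rw [← hU, multisetGenFun_image_add, Multiset.sum_singleton] at h1
  linear_combination h1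

theorem prod_one_sub_X_pow_mul_multisetGenFun (F : Finset ℕ) {S : Set ℕ} (hF : ↑F ⊆ S)
    (hS : 0 ∉ S) :
    (∏ a ∈ F, (1 - PowerSeries.X ^ a)) * multisetGenFun (multisetsIn S) =
      multisetGenFun (multisetsIn (S \ F)) := by
  induction F using Finset.induction_on with
  | empty => simp
  | insert a F ha ih =>
    rw [Finset.coe_insert, Set.insert_subset_iff] at hF
    rw [Finset.prod_insert ha, mul_assoc, ih hF.2,
      one_sub_X_pow_mul_multisetGenFun (S := S \ F) ⟨hF.1, by simpa using ha⟩ fun h => hS h.1]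
    congr 2
    ext y
    simp only [Set.mem_sdiff, Finset.coe_insert, Set.mem_insert_iff, Set.mem_singleton_iff]
    tauto

/-! ### The finite Jacobi triple product -/

theorem choose_two_succ (n : ℕ) : (n + 1).choose 2 = n + n.choose 2 := by
  simp [Nat.choose_succ_succ']

theorem choose_two_add (a b : ℕ) :
    (a + b).choose 2 = a.choose 2 + b.choose 2 + a * b := by
  induction b with
  | zero => simp
  | succ b ih => rw [← add_assoc, choose_two_succ, ih, choose_two_succ]; ring

theorem sq_eq_two_mul_choose_two_add (n : ℕ) : n * n = 2 * n.choose 2 + n := by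
  induction n with
  | zero => simp
  | succ n ih => rw [choose_two_succ]; linarith

/-- With `q = x ^ (a + b)`, extracting `-x ^ a * q ^ j` from the `j`-th factor leaves `1 - x ^ b * q
^ (N - 1 - j)`; the order of the factors is reversed. -/
theorem prod_pow_mul_sub_eq {R : Type*} [CommRing R] (x : R) (a b N : ℕ) :
    ∏ j ∈ Finset.range N, ((x ^ (a + b)) ^ N + -x ^ a * (x ^ (a + b)) ^ j) =
      (-1) ^ N * x ^ (a * N + (a + b) * N.choose 2) *
        ∏ j ∈ Finset.range N, (1 - x ^ b * (x ^ (a + b)) ^ j) := by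
  induction N with
  | zero => simp
  | succ N ih =>
    rw [Finset.prod_range_succ']
    have h : ∀ j, (x ^ (a + b)) ^ (N + 1) + -x ^ a * (x ^ (a + b)) ^ (j + 1) =
        x ^ (a + b) * ((x ^ (a + b)) ^ N + -x ^ a * (x ^ (a + b)) ^ j) := fun j => by ring
    simp only [h, Finset.prod_mul_distrib, Finset.prod_const, Finset.card_range, ih]
    rw [Finset.prod_range_succ, choose_two_succ]
    ring

theorem sum_range_two_mul_add_one {R : Type*} [AddCommMonoid R] (f : ℕ → R) (N : ℕ) :
    ∑ r ∈ Finset.range (2 * N + 1), f r =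
      ∑ n ∈ Finset.range (N + 1), f (N + n) + ∑ n ∈ Finset.range N, f (N - (n + 1)) := by
  rw [two_mul, add_assoc, Finset.sum_range_add, add_comm, ← Finset.sum_range_reflect f N]
  congr 1
  exact Finset.sum_congr rfl fun n _ => by rw [Nat.sub_sub, add_comm 1 n]

/-- A finite form of the Jacobi triple product identity. -/
theorem finite_jacobi_triple_product {R : Type*} [CommRing R] [IsDomain R] {x : R} (hx : x ≠ 0)
    (a b N : ℕ) :
    (∏ j ∈ Finset.range N, (1 - x ^ a * (x ^ (a + b)) ^ j)) *
        ∏ j ∈ Finset.range N, (1 - x ^ b * (x ^ (a + b)) ^ j) =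
      ∑ n ∈ Finset.range (N + 1), gaussBinom (x ^ (a + b)) (2 * N) (N + n) *
        ((-1) ^ n * x ^ ((a + b) * n.choose 2 + a * n)) +
      ∑ n ∈ Finset.range N, gaussBinom (x ^ (a + b)) (2 * N) (N - (n + 1)) *
        ((-1) ^ (n + 1) * x ^ ((a + b) * (n + 1).choose 2 + b * (n + 1))) := by
  -- Multiplying by this monomial clears the negative powers that centring the `q`-binomial sum at
  -- `r = N` would create.
  have hP : (-1) ^ N * x ^ (a * N + (a + b) * (N.choose 2 + N * N)) ≠ 0 :=
    mul_ne_zero (pow_ne_zero _ (neg_ne_zero.2 one_ne_zero)) (pow_ne_zero _ hx)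
  refine mul_left_cancel₀ hP ?_
  have h := prod_add_mul_pow_eq_sum_gaussBinom (x ^ (a + b)) ((x ^ (a + b)) ^ N) (-x ^ a) (2 * N)
  rw [sum_range_two_mul_add_one, two_mul, Finset.prod_range_add, prod_pow_mul_sub_eq,
    ← two_mul] at h
  have h2 : ∏ j ∈ Finset.range N, ((x ^ (a + b)) ^ N + -x ^ a * (x ^ (a + b)) ^ (N + j)) =
      x ^ ((a + b) * (N * N)) * ∏ j ∈ Finset.range N, (1 - x ^ a * (x ^ (a + b)) ^ j) := by
    have h3 : ∀ j, (x ^ (a + b)) ^ N + -x ^ a * (x ^ (a + b)) ^ (N + j) =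
        (x ^ (a + b)) ^ N * (1 - x ^ a * (x ^ (a + b)) ^ j) := fun j => by ring
    simp only [h3, Finset.prod_mul_distrib, Finset.prod_const, Finset.card_range]
    ring
  rw [h2] at h
  rw [mul_add ((-1 : R) ^ N * x ^ (a * N + _)), Finset.mul_sum, Finset.mul_sum]
  convert h using 1
  · ring
  congr 1
  · refine Finset.sum_congr rfl fun n hn => ?_
    obtain ⟨d, rfl⟩ := Nat.exists_eq_add_of_le (Nat.lt_succ_iff.1 (Finset.mem_range.1 hn))
    have e : 2 * (n + d) - (n + d + n) = d := by omega
    rw [e, neg_pow, choose_two_add (n + d) n]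
    have e2 : a * (n + d) + (a + b) * ((n + d).choose 2 + (n + d) * (n + d)) +
        ((a + b) * n.choose 2 + a * n) =
        (a + b) * ((n + d).choose 2 + n.choose 2 + (n + d) * n) + a * (n + d + n) +
        (a + b) * ((n + d) * d) := by ring
    calc _ = gaussBinom (x ^ (a + b)) (2 * (n + d)) (n + d + n) * (-1) ^ (n + d + n) *
          x ^ (a * (n + d) + (a + b) * ((n + d).choose 2 + (n + d) * (n + d)) +
            ((a + b) * n.choose 2 + a * n)) := by ring
      _ = _ := by rw [e2]; ring
  · refine Finset.sum_congr rfl fun n hn => ?_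
    obtain ⟨d, rfl⟩ := Nat.exists_eq_add_of_le (Nat.succ_le_iff.2 (Finset.mem_range.1 hn))
    simp only [Nat.succ_eq_add_one]
    generalize n + 1 = k
    have e : 2 * (k + d) - (k + d - k) = k + d + k := by omega
    rw [e, Nat.add_sub_cancel_left, neg_pow, choose_two_add k d]
    have := sq_eq_two_mul_choose_two_add k
    have e2 : a * (k + d) + (a + b) * (k.choose 2 + d.choose 2 + k * d + (k + d) * (k + d)) +
        ((a + b) * k.choose 2 + b * k) =
        (a + b) * d.choose 2 + a * d + (a + b) * ((k + d) * (k + d + k)) := by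
      linear_combination (a + b) * this.symm
    have e3 : (-1 : R) ^ (k + d) * (-1) ^ k = (-1) ^ d := by
      rw [pow_add, mul_right_comm, ← mul_pow]; simp
    calc _ = gaussBinom (x ^ (a + b)) (2 * (k + d)) d * ((-1) ^ (k + d) * (-1) ^ k) *
          x ^ (a * (k + d) + (a + b) * (k.choose 2 + d.choose 2 + k * d + (k + d) * (k + d)) +
            ((a + b) * k.choose 2 + b * k)) := by ring
      _ = _ := by rw [e2, e3]; ring

/-! ### The triple product modulo `X ^ L` -/

theorem pow_dvd_prod_one_sub_sub_one {R : Type*} [CommRing R] (q : R) (p s : ℕ) :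
    q ^ (p + 1) ∣ ∏ j ∈ Finset.range s, (1 - q ^ (p + j + 1)) - 1 := by
  induction s with
  | zero => simp
  | succ s ih =>
    rw [Finset.prod_range_succ]
    have h : q ^ (p + 1) ∣ q ^ (p + s + 1) := pow_dvd_pow _ (by omega)
    have := (ih.mul_right (1 - q ^ (p + s + 1))).sub h
    convert this using 1
    ring

theorem isUnit_prod_one_sub {ι : Type*} (F : Finset ι) (f : ι → PowerSeries ℤ)
    (h : ∀ y ∈ F, PowerSeries.constantCoeff (f y) = 0) : IsUnit (∏ y ∈ F, (1 - f y)) := by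
  rw [PowerSeries.isUnit_iff_constantCoeff, map_prod, Finset.prod_eq_one]
  · exact isUnit_one
  · intro y hy
    rw [map_sub, h y hy, map_one, sub_zero]

theorem constantCoeff_X_pow_of_pos {n : ℕ} (h : 0 < n) :
    PowerSeries.constantCoeff ((PowerSeries.X : PowerSeries ℤ) ^ n) = 0 := by
  rw [map_pow, PowerSeries.constantCoeff_X, zero_pow h.ne']

open PowerSeries in
theorem isUnit_qFactorial {M : ℕ} (hM : 0 < M) (N : ℕ) :
    IsUnit (qFactorial ((X : PowerSeries ℤ) ^ M) N) :=
  isUnit_prod_one_sub _ _ fun j _ => by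
    rw [← pow_mul]; exact constantCoeff_X_pow_of_pos (Nat.mul_pos hM j.succ_pos)

open PowerSeries in
-- Writing each factorial as the one of index `d` times a tail, `B` is a quotient of tails divided
-- by that common factorial. Every tail is `1` modulo `(X ^ M) ^ (d + 1)`.
theorem pow_dvd_qFactorial_mul_sub_one {M : ℕ} (hM : 0 < M) {n d : ℕ} {B : PowerSeries ℤ}
    (hB : B * qFactorial (X ^ M) (d + (n + n)) * qFactorial (X ^ M) d =
      qFactorial (X ^ M) (2 * (d + n))) :
    (X ^ M) ^ (d + 1) ∣ qFactorial (X ^ M) (d + n) * B - 1 := by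
  rw [show 2 * (d + n) = d + (d + (n + n)) by ring] at hB
  simp only [qFactorial_add _ d] at hB ⊢
  have hu := pow_dvd_prod_one_sub_sub_one ((X : PowerSeries ℤ) ^ M) d n
  have hv := pow_dvd_prod_one_sub_sub_one ((X : PowerSeries ℤ) ^ M) d (n + n)
  have hw := pow_dvd_prod_one_sub_sub_one ((X : PowerSeries ℤ) ^ M) d (d + (n + n))
  have hA := (isUnit_qFactorial hM d).ne_zero
  generalize ∏ j ∈ Finset.range n, (1 - ((X : PowerSeries ℤ) ^ M) ^ (d + j + 1)) = u at *
  generalize ∏ j ∈ Finset.range (n + n), (1 - ((X : PowerSeries ℤ) ^ M) ^ (d + j + 1)) = v at *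
  generalize ∏ j ∈ Finset.range (d + (n + n)), (1 - ((X : PowerSeries ℤ) ^ M) ^ (d + j + 1)) = w
    at *
  generalize qFactorial ((X : PowerSeries ℤ) ^ M) d = A at *
  have h : B * v * A = w := mul_left_cancel₀ hA (by linear_combination hB)
  have h2 := ((hw.mul_left u).add hu).sub (hv.mul_left (A * u * B))
  convert h2 using 1
  linear_combination u * h

open PowerSeries in
-- The Gaussian binomial is controlled only to order about `d = L - n`; the factor `X ^ (a * n)`
-- supplies the missing `n`.
theorem X_pow_dvd_term {a M L n d : ℕ} (ha : 0 < a) (hM : 0 < M) (hL : d + n = L)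
    {B : PowerSeries ℤ} (hB : B * qFactorial (X ^ M) (d + (n + n)) * qFactorial (X ^ M) d =
      qFactorial (X ^ M) (2 * (d + n))) (c : ℕ) (s : PowerSeries ℤ) :
    X ^ L ∣ qFactorial (X ^ M) L * (B * (s * X ^ (c + a * n))) - s * X ^ (c + a * n) := by
  subst hL
  have h1 := pow_dvd_qFactorial_mul_sub_one hM hB
  have h2 : (X : PowerSeries ℤ) ^ (d + n) ∣ (X ^ M) ^ (d + 1) * X ^ (c + a * n) := by
    rw [← pow_mul, ← pow_add]
    refine pow_dvd_pow _ ?_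
    have := Nat.le_mul_of_pos_left (d + 1) hM
    have := Nat.le_mul_of_pos_left n ha
    omega
  convert (h2.trans (mul_dvd_mul_right h1 _)).mul_left s using 1
  ring

open PowerSeries in
/-- The Jacobi triple product, modulo `X ^ L`, in the form needed for Andrews' series. -/
theorem X_pow_dvd_jacobi_triple_product_sub {i : ℕ} (hi : 0 < i) (l L : ℕ) :
    (X : PowerSeries ℤ) ^ L ∣
      qFactorial (X ^ (i + (i + 2 * l + 1))) L *
        ((∏ j ∈ Finset.range L, (1 - X ^ (i + 2 * l + 1) * (X ^ (i + (i + 2 * l + 1))) ^ j)) *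
        ∏ j ∈ Finset.range L, (1 - X ^ i * (X ^ (i + (i + 2 * l + 1))) ^ j)) -
      ∑ n ∈ Finset.range L, andrewsTerm X i l 0 n := by
  set b := i + 2 * l + 1 with hb
  have hM : 0 < b + i := by omega
  rw [add_comm i b, finite_jacobi_triple_product X_ne_zero]
  -- At `m = 0` the factor `1 - x ^ (i * (2 * n + 1))` splits each term into the theta terms of
  -- indices `n` and `-(n + 1)`.
  have hterm : ∀ n, andrewsTerm (X : PowerSeries ℤ) i l 0 n =
      (-1) ^ n * X ^ ((b + i) * n.choose 2 + b * n) +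
        (-1) ^ (n + 1) * X ^ ((b + i) * (n + 1).choose 2 + i * (n + 1)) := by
    intro n
    rw [andrewsTerm, choose_two_succ, hb]
    simp only [Finset.range_zero, Finset.prod_empty]
    ring
  simp only [hterm, Finset.sum_add_distrib]
  have h1 : (X : PowerSeries ℤ) ^ L ∣ ∑ n ∈ Finset.range (L + 1),
      (qFactorial (X ^ (b + i)) L * (gaussBinom (X ^ (b + i)) (2 * L) (L + n) *
        ((-1) ^ n * X ^ ((b + i) * n.choose 2 + b * n))) -
        (-1) ^ n * X ^ ((b + i) * n.choose 2 + b * n)) := by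
    refine Finset.dvd_sum fun n hn => ?_
    obtain ⟨d, rfl⟩ := Nat.exists_eq_add_of_le' (Nat.lt_succ_iff.1 (Finset.mem_range.1 hn))
    refine X_pow_dvd_term (by omega) hM rfl ?_ _ _
    rw [← add_assoc d n n]
    have := gaussBinom_mul_qFactorial ((X : PowerSeries ℤ) ^ (b + i)) d (d + (n + n))
    rwa [show d + (d + (n + n)) = 2 * (d + n) by ring, ← add_assoc d n n] at this

  have h2 : (X : PowerSeries ℤ) ^ L ∣ ∑ n ∈ Finset.range L,
      (qFactorial (X ^ (b + i)) L * (gaussBinom (X ^ (b + i)) (2 * L) (L - (n + 1)) *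
        ((-1) ^ (n + 1) * X ^ ((b + i) * (n + 1).choose 2 + i * (n + 1)))) -
        (-1) ^ (n + 1) * X ^ ((b + i) * (n + 1).choose 2 + i * (n + 1))) := by
    refine Finset.dvd_sum fun n hn => ?_
    obtain ⟨d, rfl⟩ := Nat.exists_eq_add_of_le' (Nat.succ_le_iff.2 (Finset.mem_range.1 hn))
    refine X_pow_dvd_term (d := d) hi hM rfl ?_ _ _
    have := gaussBinom_mul_qFactorial ((X : PowerSeries ℤ) ^ (b + i)) (d + (n + 1 + (n + 1))) d
    rw [show d + (n + 1 + (n + 1)) + d = 2 * (d + (n + 1)) by ring] at this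
    rw [Nat.succ_eq_add_one, Nat.add_sub_cancel, ← this]
    ring
  -- The nonnegative half of the finite identity has one term, `n = L`, more than the truncated
  -- series.
  have h3 : (X : PowerSeries ℤ) ^ L ∣ (-1) ^ L * X ^ ((b + i) * L.choose 2 + b * L) :=
    (pow_dvd_pow _ ((Nat.le_mul_of_pos_left L (by omega)).trans (Nat.le_add_left _ _))).mul_left _
  have h := (h1.add h2).add h3
  rw [Finset.sum_sub_distrib, Finset.sum_sub_distrib, ← Finset.mul_sum, ← Finset.mul_sum,
    Finset.sum_range_succ (fun n => (-1) ^ n * (X : PowerSeries ℤ) ^ _)] at h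
  convert h using 1
  ring

/-! ### Residue classes and Gordon's theorem -/

/-- Integers congruent to none of `0`, `a`, `b` modulo `a + b`. -/
def avoidResidues (a b : ℕ) : Set ℕ :=
  {y | ¬ (a + b) ∣ y ∧ ¬ y ≡ a [MOD a + b] ∧ ¬ y ≡ b [MOD a + b]}

theorem zero_notMem_avoidResidues (a b : ℕ) : 0 ∉ avoidResidues a b :=
  fun h => h.1 (dvd_zero _)

theorem mem_avoidResidues_mul_add {a b L r : ℕ} (ha : 0 < a) (hb : 0 < b) (hr : 0 < r)
    (hrM : r ≤ a + b) :
    (a + b) * L + r ∈ avoidResidues a b ↔ r ≠ a ∧ r ≠ b ∧ r ≠ a + b := by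
  have h1 : (a + b) ∣ (a + b) * L + r ↔ r = a + b := by
    rw [Nat.dvd_add_right (Dvd.intro _ rfl)]
    exact ⟨fun h => le_antisymm hrM (Nat.le_of_dvd hr h), fun h => h ▸ dvd_rfl⟩
  have h2 : ∀ c, 0 < c → c < a + b → ((a + b) * L + r ≡ c [MOD a + b] ↔ r = c) := by
    intro c hc hcM
    rw [Nat.ModEq, Nat.mul_add_mod, Nat.mod_eq_of_lt hcM]
    rcases hrM.lt_or_eq with h | h
    · rw [Nat.mod_eq_of_lt h]
    · rw [h, Nat.mod_self]; omega
  simp only [avoidResidues, Set.mem_ofPred_eq, h1, h2 a ha (by omega), h2 b hb (by omega)]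
  tauto

open PowerSeries in
theorem prod_residues_one_sub_X_pow {a b : ℕ} [DecidablePred (· ∈ avoidResidues a b)] (ha : 0 < a) (hb : 0 < b) (hab : a ≠ b) (L : ℕ) :
    ∏ y ∈ Finset.Ioc 0 ((a + b) * L) with y ∉ avoidResidues a b,
        (1 - (X : PowerSeries ℤ) ^ y) =
      qFactorial (X ^ (a + b)) L *
        ((∏ j ∈ Finset.range L, (1 - X ^ b * (X ^ (a + b)) ^ j)) *
          ∏ j ∈ Finset.range L, (1 - X ^ a * (X ^ (a + b)) ^ j)) := by
  induction L with
  | zero => simp [qFactorial]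
  | succ L ih =>
    -- Each block of `a + b` consecutive integers contributes three excluded ones, distinct since `a
    -- ≠ b`.
    have hset : {y ∈ Finset.Ioc 0 ((a + b) * (L + 1)) | y ∉ avoidResidues a b} =
        {y ∈ Finset.Ioc 0 ((a + b) * L) | y ∉ avoidResidues a b} ∪
          {(a + b) * L + a, (a + b) * L + b, (a + b) * L + (a + b)} := by
      ext y
      simp only [Finset.mem_filter, Finset.mem_Ioc, Finset.mem_union, Finset.mem_insert,
        Finset.mem_singleton, mul_add_one]
      rcases Nat.lt_or_ge ((a + b) * L) y with h | h
      · obtain ⟨r, rfl⟩ := Nat.exists_eq_add_of_lt h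
        rw [add_assoc]
        by_cases hr : r + 1 ≤ a + b
        · rw [mem_avoidResidues_mul_add ha hb r.succ_pos hr]
          omega
        · omega
      · have : y ≠ (a + b) * L + a ∧ y ≠ (a + b) * L + b ∧ y ≠ (a + b) * L + (a + b) := by omega
        constructor
        · rintro ⟨h1, h2⟩; exact Or.inl ⟨⟨h1.1, h⟩, h2⟩
        · rintro (⟨h1, h2⟩ | h1)
          · exact ⟨⟨h1.1, by omega⟩, h2⟩
          · omega
    rw [hset, Finset.prod_union, ih, Finset.prod_insert, Finset.prod_insert,
      Finset.prod_singleton, Finset.prod_range_succ, Finset.prod_range_succ, qFactorial_succ]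
    · ring
    · simp; omega
    · simp; omega
    · rw [Finset.disjoint_left]
      intro y hy
      simp only [Finset.mem_filter, Finset.mem_Ioc] at hy
      simp only [Finset.mem_insert, Finset.mem_singleton]
      omega

open PowerSeries in
theorem prod_Ioc_one_sub_X_pow (N : ℕ) :
    ∏ y ∈ Finset.Ioc 0 N, (1 - (X : PowerSeries ℤ) ^ y) = qFactorial X N := by
  induction N with
  | zero => simp [qFactorial]
  | succ N ih => rw [← Finset.insert_Ioc_right_eq_Ioc_add_one (Nat.zero_le _),
      Finset.prod_insert (by simp), ih, qFactorial_succ, mul_comm]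

open PowerSeries in
/-- Gordon's generating function agrees with Andrews' series modulo `X ^ L`. -/
theorem X_pow_dvd_qFactorial_mul_sub_sum_andrewsTerm {L N : ℕ} (hL : 0 < L) (hN : L ≤ N)
    (i l : ℕ) :
    (X : PowerSeries ℤ) ^ L ∣ ∑ n ∈ Finset.range L, andrewsTerm X i l 0 n -
      qFactorial X N * multisetGenFun (gordonSet i l 0) := by
  -- In this quotient `X` is nilpotent, as the uniqueness argument for the recurrence requires.
  set φ := Ideal.Quotient.mk (Ideal.span {(X : PowerSeries ℤ) ^ L}) with hφ
  have hdvd : ∀ {f g : PowerSeries ℤ}, φ f = φ g ↔ (X : PowerSeries ℤ) ^ L ∣ f - g := by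
    intro f g
    rw [hφ, Ideal.Quotient.eq, Ideal.mem_span_singleton]
  have hx : φ X ^ L = 0 := by
    rw [← map_pow, ← map_zero φ, hdvd, sub_zero]
  have hq : ∀ n, φ (qFactorial X n) = qFactorial (φ X) n := fun n => by
    simp [qFactorial, map_prod]
  rw [← hdvd, map_mul, hq, qFactorial_eq_of_le hx hN, map_sum,
    ← sum_andrewsTerm_eq_qFactorial_mul hL hx (fun i l m => φ (multisetGenFun (gordonSet i l m)))]
  · exact Finset.sum_congr rfl fun n _ => by simp [andrewsTerm]
  · intro l m
    rw [multisetGenFun_gordonSet_zero, map_zero]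
  · intro i l m
    rw [multisetGenFun_gordonSet_succ, map_add, map_mul, map_pow]
  · intro i l m h
    rw [← map_one φ, hdvd]
    exact (pow_dvd_pow _ h).trans (X_pow_dvd_multisetGenFun_gordonSet_sub_one i l m)

open PowerSeries in
-- Modulo `X ^ L`, the product over all `y ≤ N` times the Gordon series is Andrews' series, hence
-- the product over excluded residues. The product over allowed residues times the other series is
-- `1`. Both finite products are units and cancel.
theorem multisetGenFun_gordonSet_eq {i : ℕ} (hi : 0 < i) (l : ℕ) :
    multisetGenFun (gordonSet i l 0) =
      multisetGenFun (multisetsIn (avoidResidues i (i + 2 * l + 1))) := by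
  classical
  suffices h : ∀ L, 0 < L → (X : PowerSeries ℤ) ^ L ∣ multisetGenFun (gordonSet i l 0) -
      multisetGenFun (multisetsIn (avoidResidues i (i + 2 * l + 1))) by
    ext n
    have := X_pow_dvd_iff.1 (h (n + 1) n.succ_pos) n n.lt_succ_self
    rwa [map_sub, sub_eq_zero] at this
  intro L hL
  have hb : 0 < i + 2 * l + 1 := Nat.succ_pos _
  have hN : L ≤ (i + (i + 2 * l + 1)) * L := Nat.le_mul_of_pos_left L (by omega)
  have hK := X_pow_dvd_qFactorial_mul_sub_sum_andrewsTerm hL hN i l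
  have hJ := X_pow_dvd_jacobi_triple_product_sub hi l L
  rw [← prod_residues_one_sub_X_pow hi hb (by omega)] at hJ
  generalize i + 2 * l + 1 = b at *
  set N := (i + b) * L
  rw [← prod_Ioc_one_sub_X_pow,
    ← Finset.prod_filter_mul_prod_filter_not _ (· ∈ avoidResidues i b)] at hK
  have hP := prod_one_sub_X_pow_mul_multisetGenFun
    {y ∈ Finset.Ioc 0 N | y ∈ avoidResidues i b} (S := avoidResidues i b)
    (fun y hy => (Finset.mem_filter.1 hy).2) (zero_notMem_avoidResidues i b)
  have hP1 : (X : PowerSeries ℤ) ^ L ∣ multisetGenFun (multisetsIn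
      (avoidResidues i b \ ↑{y ∈ Finset.Ioc 0 N | y ∈ avoidResidues i b})) - 1 := by
    refine X_pow_dvd_multisetGenFun_sub_one (by simp [multisetsIn]) fun s hs y hy => ?_
    have hy' := hs y hy
    by_contra hlt
    refine hy'.2 (Finset.mem_coe.2 (Finset.mem_filter.2 ⟨Finset.mem_Ioc.2 ⟨?_, by omega⟩, hy'.1⟩))
    exact Nat.pos_of_ne_zero fun h => zero_notMem_avoidResidues i b (h ▸ hy'.1)
  rw [← hP] at hP1
  have hunit : ∀ (p : ℕ → Prop) [DecidablePred p], IsUnit (∏ y ∈ Finset.Ioc 0 N with p y,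
      (1 - (X : PowerSeries ℤ) ^ y)) := fun p _ => isUnit_prod_one_sub _ _ fun y hy =>
    constantCoeff_X_pow_of_pos (Finset.mem_Ioc.1 (Finset.mem_filter.1 hy).1).1
  rw [← ((hunit (· ∈ avoidResidues i b)).mul (hunit (· ∉ avoidResidues i b))).dvd_mul_left]
  have h := (hK.add hJ).add
    (hP1.mul_left (∏ y ∈ Finset.Ioc 0 N with y ∉ avoidResidues i b, (1 - X ^ y)))
  rw [← dvd_neg]
  convert h using 1
  ring

theorem coeff_multisetGenFun {C : Set (Multiset ℕ)} (hC : ∀ s ∈ C, 0 ∉ s) (n : ℕ) :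
    PowerSeries.coeff n (multisetGenFun C) = ({p : n.Partition | p.parts ∈ C}.ncard : ℤ) := by
  rw [multisetGenFun, PowerSeries.coeff_mk]
  have h : {s | s ∈ C ∧ s.sum = n} = Nat.Partition.parts '' {p : n.Partition | p.parts ∈ C} := by
    ext s
    constructor
    · rintro ⟨hs, hn⟩
      exact ⟨⟨s, fun {a} ha => Nat.pos_of_ne_zero fun h => hC s hs (h ▸ ha), hn⟩, hs, rfl⟩
    · rintro ⟨p, hp, rfl⟩
      exact ⟨hp, p.parts_sum⟩
  rw [h, Set.ncard_image_of_injective _ fun p q => Nat.Partition.ext]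

/-- **Gordon's partition theorem**, the combinatorial generalization of the Rogers-Ramanujan
identities. -/
theorem ncard_gordonCondition {d i : ℕ} (hi : 1 ≤ i) (hid : i ≤ d) (n : ℕ) :
    {p : n.Partition | p.GordonCondition d i}.ncard =
      {p : n.Partition | ∀ x ∈ p.parts, x ∈ avoidResidues i (2 * d + 1 - i)}.ncard := by
  obtain ⟨l, rfl⟩ := Nat.exists_eq_add_of_le hid
  have hb : 2 * (i + l) + 1 - i = i + 2 * l + 1 := by omega
  have h := congrArg (PowerSeries.coeff n) (multisetGenFun_gordonSet_eq hi l)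
  rw [coeff_multisetGenFun gordonSet_zero_notMem, coeff_multisetGenFun
    (C := multisetsIn _) fun s hs h => zero_notMem_avoidResidues _ _ (hs 0 h), Nat.cast_inj] at h
  rw [hb]
  refine Eq.trans ?_ h
  congr 1
  ext p
  simp only [Nat.Partition.GordonCondition, gordonSet, Set.mem_ofPred_eq]
  constructor
  · rintro ⟨h1, h2⟩
    exact ⟨fun y hy => p.parts_pos hy, by rw [zero_add]; omega,
      fun j hj => by have := h2 j hj; omega⟩
  · rintro ⟨-, h1, h2⟩
    rw [zero_add] at h1
    exact ⟨by omega, fun j hj => by have := h2 j hj; omega⟩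

theorem gordonCondition_succ {n d : ℕ} (hd : 1 ≤ d) (p : n.Partition) :
    p.GordonCondition d (d + 1) ↔ p.GordonCondition d d := by
  constructor
  · rintro ⟨-, h⟩
    exact ⟨by have := h 1 le_rfl; omega, h⟩
  · rintro ⟨h1, h⟩
    exact ⟨by omega, h⟩

/-! ### From alternating sums to residues -/

theorem ncard_preimage_eq_of_ncard_fiber_eq {α β γ : Type*} [Finite α] [Finite β] {A : Set α}
    {B : Set β} (f : α → γ) (g : β → γ)
    (h : ∀ s, {a | a ∈ A ∧ f a = s}.ncard = {b | b ∈ B ∧ g b = s}.ncard) (T : Set γ) :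
    {a | a ∈ A ∧ f a ∈ T}.ncard = {b | b ∈ B ∧ g b ∈ T}.ncard := by
  classical
  have := Fintype.ofFinite α
  have := Fintype.ofFinite β
  simp only [Set.ncard_eq_toFinset_card', Set.toFinset_ofPred] at h ⊢
  set t := {s ∈ Finset.univ.image f ∪ Finset.univ.image g | s ∈ T} with ht
  rw [Finset.card_eq_sum_card_fiberwise (f := f) (t := t),
    Finset.card_eq_sum_card_fiberwise (f := g) (t := t)]
  · refine Finset.sum_congr rfl fun s hs => ?_
    have hsT : s ∈ T := (Finset.mem_filter.1 hs).2
    convert h s using 2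
    · ext a
      simp only [Finset.mem_filter, Finset.mem_univ, true_and]
      exact ⟨fun h => ⟨h.1.1, h.2⟩, fun h => ⟨⟨h.1, h.2 ▸ hsT⟩, h.2⟩⟩
    · ext a
      simp only [Finset.mem_filter, Finset.mem_univ, true_and]
      exact ⟨fun h => ⟨h.1.1, h.2⟩, fun h => ⟨⟨h.1, h.2 ▸ hsT⟩, h.2⟩⟩
  · intro b hb
    simp only [Finset.coe_filter, Finset.mem_univ, true_and, Set.mem_ofPred_eq] at hb
    simp [ht, hb.2]
  · intro a ha
    simp only [Finset.coe_filter, Finset.mem_univ, true_and, Set.mem_ofPred_eq] at ha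
    simp [ht, ha.2]

theorem EulerConjecture.ncard_preimage_eq {m : ℕ} (h : EulerConjecture m) (n : ℕ)
    (T : Set (Finset.Icc 1 (m - 1) → ℕ)) :
    {p : n.Partition | p.RepeatedAtMost (m - 1) ∧
      (fun c : Finset.Icc 1 (m - 1) => p.altSum m c) ∈ T}.ncard =
    {p : n.Partition | (∀ x ∈ p.parts, ¬ m ∣ x) ∧
      (fun c : Finset.Icc 1 (m - 1) => p.lengthType m c) ∈ T}.ncard := by
  refine ncard_preimage_eq_of_ncard_fiber_eq
    (A := {p : n.Partition | p.RepeatedAtMost (m - 1)})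
    (B := {p : n.Partition | ∀ x ∈ p.parts, ¬ m ∣ x})
    (fun p (c : Finset.Icc 1 (m - 1)) => p.altSum m c)
    (fun p (c : Finset.Icc 1 (m - 1)) => p.lengthType m c) (fun s => ?_) T
  classical
  -- Types become functions on the finite index set, so that `T` cannot see entries outside it;
  -- extension by `0` matches the form of the conjecture.
  have key : ∀ F : ℕ → ℕ, (fun c : Finset.Icc 1 (m - 1) => F c) = s ↔
      ∀ c ∈ Finset.Icc 1 (m - 1), F c = if hc : c ∈ Finset.Icc 1 (m - 1) then s ⟨c, hc⟩ else 0 := by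
    intro F
    constructor
    · rintro rfl c hc
      rw [dif_pos hc]
    · intro hF
      ext ⟨c, hc⟩
      rw [hF c hc, dif_pos hc]
  simp only [key, Set.mem_ofPred_eq]
  exact h n _

theorem lengthType_eq_zero_iff {n m c : ℕ} (p : n.Partition) :
    p.lengthType m c = 0 ↔ ∀ x ∈ p.parts, ¬ x ≡ c [MOD m] := by
  rw [Nat.Partition.lengthType, Multiset.card_eq_zero, Multiset.filter_eq_nil]

theorem EulerConjecture.ncard_altSum_eq {a b : ℕ} (ha : 0 < a) (hb : 0 < b)
    (h : EulerConjecture (a + b)) {n : ℕ} (hn : 1 ≤ n) :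
    {p : n.Partition | p.RepeatedAtMost (a + b - 1) ∧
        (∃ c ∈ Finset.Icc 1 (a + b - 1), p.altSum (a + b) c ≠ 0) ∧
        p.altSum (a + b) a = 0 ∧ p.altSum (a + b) b = 0}.ncard =
      {p : n.Partition | ∀ x ∈ p.parts, x ∈ avoidResidues a b}.ncard := by
  have haI : a ∈ Finset.Icc 1 (a + b - 1) := Finset.mem_Icc.2 (by omega)
  have hbI : b ∈ Finset.Icc 1 (a + b - 1) := Finset.mem_Icc.2 (by omega)
  have h1 := h.ncard_preimage_eq n {s | (∃ c, s c ≠ 0) ∧ s ⟨a, haI⟩ = 0 ∧ s ⟨b, hbI⟩ = 0}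
  convert h1 using 2
  · ext p
    simp [Subtype.exists]
  · ext p
    simp only [Set.mem_ofPred_eq, lengthType_eq_zero_iff, avoidResidues, ne_eq]
    constructor
    · intro hp
      refine ⟨fun x hx => (hp x hx).1, ?_, fun x hx => (hp x hx).2.1, fun x hx => (hp x hx).2.2⟩
      -- Since `n ≥ 1` there is a part, and its nonzero residue gives a nonzero entry of the length
      -- type.
      obtain ⟨x, hx⟩ : ∃ x, x ∈ p.parts := by
        by_contra! h0
        have := p.parts_sum
        rw [Multiset.eq_zero_of_forall_notMem h0, Multiset.sum_zero] at this
        omega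
      have hlt := Nat.mod_lt x (show 0 < a + b by omega)
      have hpos := Nat.pos_of_ne_zero fun h => (hp x hx).1 (Nat.dvd_of_mod_eq_zero h)
      exact ⟨⟨x % (a + b), Finset.mem_Icc.2 (by omega)⟩, fun h => h x hx (Nat.mod_modEq _ _).symm⟩
    · rintro ⟨h1, -, h2, h3⟩ x hx
      exact ⟨h1 x hx, h2 x hx, h3 x hx⟩

theorem avoidResidues_comm (a b : ℕ) : avoidResidues a b = avoidResidues b a := by
  ext y
  simp only [avoidResidues, Set.mem_ofPred_eq, add_comm a b]
  tauto

theorem theorem5p3 (d i : ℕ) (hd : 1 ≤ d) (hi : 1 ≤ i) (hid : i ≤ d + 1)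
    (hconj : EulerConjecture (2 * d + 1)) (n : ℕ) (hn : 1 ≤ n) :
    {p : n.Partition | p.GordonCondition d i}.ncard =
      {p : n.Partition | p.RepeatedAtMost (2 * d) ∧
        (∃ c ∈ Finset.Icc 1 (2 * d), p.altSum (2 * d + 1) c ≠ 0) ∧
        p.altSum (2 * d + 1) i = 0 ∧ p.altSum (2 * d + 1) (2 * d + 1 - i) = 0}.ncard := by
  have hsum : i + (2 * d + 1 - i) = 2 * d + 1 := by omega
  have h := EulerConjecture.ncard_altSum_eq (a := i) (b := 2 * d + 1 - i) hi (by omega)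
    (hsum.symm ▸ hconj) hn
  rw [hsum, Nat.add_sub_cancel] at h
  rw [h]
  rcases hid.lt_or_eq with hlt | rfl
  · exact ncard_gordonCondition hi (Nat.lt_succ_iff.1 hlt) n
  -- For `i = d + 1` the bound on ones already follows from the pair `1`, `2`, and `{d + 1, d}` is
  -- the same pair of residues as for `i = d`.
  · simp only [gordonCondition_succ hd]
    rw [ncard_gordonCondition hd le_rfl, avoidResidues_comm,
      show 2 * d + 1 - d = d + 1 by omega, show 2 * d + 1 - (d + 1) = d by omega]
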